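/- Let $I$ be a set. An \emph{$I$-dimensional cylindric Boolean algebra} is a Boolean algebra $A$ with unary operations $(\exists_i)_{i\in I}$ and constants $(\delta_{i,k})_{i,k\in I}$ such that for all $i,k,l\in I$ and $a,b\in A$: each $\exists_i$ is a quantifier, i.e. $\exists_i(a\vee b)=\exists_i a\vee\exists_i b$, $\exists_i 0=0$, $\exists_i\exists_i a=\exists_i a$, $a\le\exists_i a$ and $\exists_i\bigl((\exists_i a)^{\perp}\bigr)=(\exists_i a)^{\perp}$, where $^{\perp}$ is the Boolean complement; $\exists_i\exists_k a=\exists_k\exists_i a$; $\delta_{i,k}=\delta_{k,i}$ and $\delta_{i,i}=1$; if $k\ne i,l$, then $\delta_{i,l}=\exists_k(\delta_{i,k}\wedge\delta_{k,l})$; if $i\ne k$, then $\exists_i(\delta_{i,k}\wedge a)\wedge\exists_i(\delta_{i,k}\wedge a^{\perp})=0$. Let $\mathcal{CBA}$ be the category of these algebras and of the Boolean homomorphisms $h$ with $h(\exists_i a)=\exists_i h(a)$ and $h(\delta_{i,k})=\delta_{i,k}$. For a topological space $X$ let $x\leqslant y$ iff every open set containing $x$ contains $y$, let $\mathrm{Int}_\leqslant(U)=\{x: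 y\in U\text{ for all }y\geqslant x\}$, $\mathrm{Cl}_\leqslant(U)=\{x: y\in U\text{ for some }y\geqslant x\}$ and $U^*=\mathrm{Int}_\leqslant(X\setminus U)$, and let $\mathcal{COREG}(X)$ be the set of all compact open $U\subseteq X$ with $\mathrm{Int}_\leqslant(\mathrm{Cl}_\leqslant(U))=U$, ordered by inclusion; put $\mathcal{COREG}_X(x)=\{U\in\mathcal{COREG}(X): x\in U\}$. A \emph{UV-space} is a $T_0$-space $X$ such that $\mathcal{COREG}(X)$ is a basis of $X$ closed under $\cap$ and $^*$, and every proper filter of $\mathcal{COREG}(X)$ is of the form $\mathcal{COREG}_X(x)$ with $x\in X$. For a binary relation $S$ on $X$ put $S[U]=\{y: xSy\text{ for some }x\in U\}$. An \emph{$I$-dimensional cylindric UV-space} is a UV-space $X$ with binary relations $(S_i)_{i\in I}$ and subsets $(\Delta_{i,k})_{i,k\in I}$ such that for all $i,k,l\in I$, $x,y\in X$ and $U\in\mathcal{COREG}(X)$: $S_i$ is an equivalence relation; $S_i\circ S_k=S_k\circ S_i$; $\Delta_{i,k}^{**}=\Delta_{i,k}=\Delta_{k,i}$ and $\Delta_{i,i}=X$;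 if $i,l\ne k$, then $S_k[\Delta_{i,k}\cap\Delta_{k,l}]=\Delta_{i,l}$; if $i\ne k$, then $S_i[\Delta_{i,k}\cap U]\cap S_i[\Delta_{i,k}\cap U^*]=\emptyset$; $S_i[U]\in\mathcal{COREG}(X)$; if not $xS_iy$, then $\{S_i[V]:V\in\mathcal{COREG}_X(x)\}\ne\{S_i[V]:V\in\mathcal{COREG}_X(y)\}$; $\Delta_{i,k}$ is compact open. A \emph{cylindric UV-map} $f\colon X\to X'$ is a spectral map (continuous, with preimages of compact open sets compact) such that: if $f(x)\leqslant' y'$, there is $y\in X$ with $x\leqslant y$ and $f(y)=y'$; $S_i[f^{-1}[U]]=f^{-1}[S'_i[U]]$ for all $i\in I$ and $U\in\mathcal{COREG}(X')$; and $f^{-1}[\Delta'_{i,k}]=\Delta_{i,k}$ for all $i,k\in I$. Let $\mathcal{CUV}$ be the category of $I$-dimensional cylindric UV-spaces and cylindric UV-maps. For $X$ in $\mathcal{CUV}$ let $\mathcal{G}_0(X)=\langle\mathcal{COREG}(X);\cap,\sqcup,{}^*,\emptyset,X,(U\mapsto S_i[U])_{i\in I},(\Delta_{i,k})_{i,k\in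 I}\rangle$ with $U\sqcup V=\mathrm{Int}_\leqslant(\mathrm{Cl}_\leqslant(U\cup V))$, and for a cylindric UV-map $f$ let $\mathcal{G}_1(f)=f^{-1}$. For $A$ in $\mathcal{CBA}$ let $\mathcal{F}_0(A)$ be the set of proper (non-empty) filters of $A$ with the topology generated by the sets $\phi(a)=\{x: a\in x\}$, $a\in A$, the relations $xS_iy\iff\exists_i[x]=\exists_i[y]$, where $\exists_i[x]=\{\exists_i a: a\in x\}$, and the subsets $\Delta_{i,k}=\phi(\delta_{i,k})$; for a homomorphism $h$ let $\mathcal{F}_1(h)=h^{-1}$. Then the contravariant functors $\mathcal{G}_F=\langle\mathcal{G}_0,\mathcal{G}_1\rangle\colon\mathcal{CUV}\to\mathcal{CBA}$ and $\mathcal{F}_F=\langle\mathcal{F}_0,\mathcal{F}_1\rangle\colon\mathcal{CBA}\to\mathcal{CUV}$ constitute a dual equivalence between the categories $\mathcal{CBA}$ and $\mathcal{CUV}$. -/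

import Mathlib

open CategoryTheory

universe u v

namespace CylDual

/-! ### Order-theoretic operations in a topological space -/

section Space

variable {X : Type u} [TopologicalSpace X]

/-- The specialization order: `x ≤ y` iff every open set containing `x` contains `y`. -/
def SpecLE (x y : X) : Prop := ∀ U : Set X, IsOpen U → x ∈ U → y ∈ U

/-- Interior in the topology of upsets of the specialization order. -/
def intUp (U : Set X) : Set X := {x | ∀ y, SpecLE x y → y ∈ U}

/-- Closure in the topology of upsets of the specialization order. -/
def clUp (U : Set X) : Set X := {x | ∃ y, SpecLE x y ∧ y ∈ U}

/-- The operation `U ↦ U*`, i.e. `Int (X \ U)` in the upset topology. -/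
def star (U : Set X) : Set X := intUp Uᶜ

/-- Compact open subsets that are regular open in the upset topology. -/
structure IsCOREG (U : Set X) : Prop where
  isCompact : IsCompact U
  isOpen : IsOpen U
  regular : intUp (clUp U) = U

variable (X) in
/-- The poset (under inclusion) of compact open, upset-regular open subsets of `X`. -/
abbrev COREG : Type u := {U : Set X // IsCOREG U}

/-- Image of a set under a binary relation. -/
def relImage {X : Type u} (S : X → X → Prop) (U : Set X) : Set X := {y | ∃ x ∈ U, S x y}

variable (X) in
/-- UV-spaces. -/
structure IsUVSpace : Prop where
  t0 : T0Space X
  inter_mem : ∀ U V : Set X, IsCOREG U → IsCOREG V → IsCOREG (U ∩ V)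
  star_mem : ∀ U : Set X, IsCOREG U → IsCOREG (star U)
  isBasis : TopologicalSpace.IsTopologicalBasis {U : Set X | IsCOREG U}
  exists_point : ∀ F : Order.PFilter (COREG X), (F : Set (COREG X)) ≠ Set.univ →
    ∃ x : X, (F : Set (COREG X)) = {U | x ∈ U.1}

end Space

/-! ### Cylindric Boolean algebras -/

/-- A quantifier on a Boolean algebra. -/
structure IsQuantifier {A : Type u} [BooleanAlgebra A] (e : A → A) : Prop where
  map_sup : ∀ a b, e (a ⊔ b) = e a ⊔ e b
  map_bot : e ⊥ = ⊥
  idem : ∀ a, e (e a) = e a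
  le : ∀ a, a ≤ e a
  map_compl : ∀ a, e (e a)ᶜ = (e a)ᶜ

/-- `I`-dimensional cylindric Boolean algebras. -/
structure CBA (I : Type v) where
  carrier : Type u
  [ba : BooleanAlgebra carrier]
  ex : I → carrier → carrier
  diag : I → I → carrier
  quantifier : ∀ i, IsQuantifier (ex i)
  ex_comm : ∀ i k a, ex i (ex k a) = ex k (ex i a)
  diag_symm : ∀ i k, diag i k = diag k i
  diag_self : ∀ i, diag i i = ⊤
  diag_trans : ∀ i k l, k ≠ i → k ≠ l → diag i l = ex k (diag i k ⊓ diag k l)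
  diag_disj : ∀ i k a, i ≠ k → ex i (diag i k ⊓ a) ⊓ ex i (diag i k ⊓ aᶜ) = ⊥

attribute [instance] CBA.ba

/-- Homomorphisms of cylindric Boolean algebras. -/
@[ext]
structure CBA.Hom {I : Type v} (A B : CBA.{u} I) where
  toFun : A.carrier → B.carrier
  map_inf : ∀ a b, toFun (a ⊓ b) = toFun a ⊓ toFun b
  map_sup : ∀ a b, toFun (a ⊔ b) = toFun a ⊔ toFun b
  map_bot : toFun ⊥ = ⊥
  map_top : toFun ⊤ = ⊤
  map_compl : ∀ a, toFun aᶜ = (toFun a)ᶜ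
  map_ex : ∀ i a, toFun (A.ex i a) = B.ex i (toFun a)
  map_diag : ∀ i k, toFun (A.diag i k) = B.diag i k

instance (I : Type v) : Category.{u} (CBA.{u} I) where
  Hom A B := CBA.Hom A B
  id A :=
    { toFun := id
      map_inf := fun _ _ => rfl
      map_sup := fun _ _ => rfl
      map_bot := rfl
      map_top := rfl
      map_compl := fun _ => rfl
      map_ex := fun _ _ => rfl
      map_diag := fun _ _ => rfl }
  comp f g :=
    { toFun := g.toFun ∘ f.toFun
      map_inf := fun a b => by simp [f.map_inf, g.map_inf]
      map_sup := fun a b => by simp [f.map_sup, g.map_sup]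
      map_bot := by simp [f.map_bot, g.map_bot]
      map_top := by simp [f.map_top, g.map_top]
      map_compl := fun a => by simp [f.map_compl, g.map_compl]
      map_ex := fun i a => by simp [f.map_ex, g.map_ex]
      map_diag := fun i k => by simp [f.map_diag, g.map_diag] }

/-! ### Cylindric UV-spaces -/

/-- `I`-dimensional cylindric UV-spaces. -/
structure CUV (I : Type v) where
  carrier : Type u
  [top : TopologicalSpace carrier]
  S : I → carrier → carrier → Prop
  Δ : I → I → Set carrier
  isUV : IsUVSpace carrier
  equiv : ∀ i, Equivalence (S i)
  comm : ∀ i k, Relation.Comp (S i) (S k) = Relation.Comp (S k) (S i)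
  diag_regular : ∀ i k, star (star (Δ i k)) = Δ i k
  diag_symm : ∀ i k, Δ i k = Δ k i
  diag_self : ∀ i, Δ i i = Set.univ
  diag_trans : ∀ i k l, i ≠ k → l ≠ k → relImage (S k) (Δ i k ∩ Δ k l) = Δ i l
  diag_disj : ∀ i k, i ≠ k → ∀ U, IsCOREG U →
    relImage (S i) (Δ i k ∩ U) ∩ relImage (S i) (Δ i k ∩ star U) = ∅
  image_mem : ∀ i U, IsCOREG U → IsCOREG (relImage (S i) U)
  separated : ∀ i x y, ¬ S i x y →
    relImage (S i) '' {U | IsCOREG U ∧ x ∈ U} ≠ relImage (S i) '' {U | IsCOREG U ∧ y ∈ U}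
  diag_compact : ∀ i k, IsCompact (Δ i k)
  diag_open : ∀ i k, IsOpen (Δ i k)

attribute [instance] CUV.top

/-- Cylindric UV-maps. -/
@[ext]
structure CUV.Hom {I : Type v} (X Y : CUV.{u} I) where
  toFun : X.carrier → Y.carrier
  spectral : IsSpectralMap toFun
  back : ∀ x y', SpecLE (toFun x) y' → ∃ y, SpecLE x y ∧ toFun y = y'
  preimage_image : ∀ i U, IsCOREG U →
    relImage (X.S i) (toFun ⁻¹' U) = toFun ⁻¹' relImage (Y.S i) U
  preimage_diag : ∀ i k, toFun ⁻¹' Y.Δ i k = X.Δ i k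

section Lemmas

variable {X Y : Type u} [TopologicalSpace X] [TopologicalSpace Y]

lemma SpecLE.refl (x : X) : SpecLE x x := fun _ _ h => h

lemma SpecLE.trans {x y z : X} (h : SpecLE x y) (h' : SpecLE y z) : SpecLE x z :=
  fun U hU hx => h' U hU (h U hU hx)

lemma SpecLE.map {f : X → Y} (hf : Continuous f) {x y : X} (h : SpecLE x y) :
    SpecLE (f x) (f y) := fun _ hU hx => h _ (hU.preimage hf) hx

lemma star_star (U : Set X) : star (star U) = intUp (clUp U) := by
  ext x
  simp only [star, intUp, clUp, Set.mem_ofPred_eq, Set.mem_compl_iff]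
  push Not
  rfl

lemma IsCOREG.up {U : Set X} (h : IsCOREG U) {x y : X} (hxy : SpecLE x y) (hx : x ∈ U) : y ∈ U :=
  hxy U h.isOpen hx

lemma IsCOREG.star_star {U : Set X} (h : IsCOREG U) : star (star U) = U :=
  (CylDual.star_star U).trans h.regular

lemma isCOREG_empty : IsCOREG (∅ : Set X) := by
  refine ⟨isCompact_empty, isOpen_empty, ?_⟩
  ext x
  simp only [intUp, clUp, Set.mem_ofPred_eq, Set.mem_empty_iff_false, and_false, exists_false,
    iff_false]
  exact fun h => h x (SpecLE.refl x)

lemma star_empty : star (∅ : Set X) = Set.univ := by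
  ext x
  simp [star, intUp]

lemma star_union (U V : Set X) : star (U ∪ V) = star U ∩ star V := by
  ext x
  constructor
  · exact fun h => ⟨fun y hy hU => h y hy (Or.inl hU), fun y hy hV => h y hy (Or.inr hV)⟩
  · rintro ⟨h1, h2⟩ y hy (hU | hV)
    · exact h1 y hy hU
    · exact h2 y hy hV

lemma IsUVSpace.univ_mem (h : IsUVSpace X) : IsCOREG (Set.univ : Set X) :=
  star_empty (X := X) ▸ h.star_mem _ isCOREG_empty

lemma IsUVSpace.sup_mem (h : IsUVSpace X) {U V : Set X} (hU : IsCOREG U) (hV : IsCOREG V) :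
    IsCOREG (intUp (clUp (U ∪ V))) :=
  star_star (U ∪ V) ▸ star_union U V ▸ h.star_mem _ (h.inter_mem _ _ (h.star_mem _ hU) (h.star_mem _ hV))

/-- The Boolean algebra `⟨COREG(X); ∩, ⊔, *, ∅, X⟩`, with `U ⊔ V = Int (Cl (U ∪ V))` computed in
the upset topology. Its order is inclusion. -/
abbrev IsUVSpace.booleanAlgebra (h : IsUVSpace X) : BooleanAlgebra (COREG X) where
  toPartialOrder := inferInstance
  inf U V := ⟨U.1 ∩ V.1, h.inter_mem _ _ U.2 V.2⟩
  sup U V := ⟨intUp (clUp (U.1 ∪ V.1)), h.sup_mem U.2 V.2⟩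
  compl U := ⟨star U.1, h.star_mem _ U.2⟩
  bot := ⟨∅, isCOREG_empty⟩
  top := ⟨Set.univ, h.univ_mem⟩
  inf_le_left _ _ := fun _ hx => hx.1
  inf_le_right _ _ := fun _ hx => hx.2
  le_inf _ _ _ h1 h2 := fun _ hx => ⟨h1 hx, h2 hx⟩
  le_sup_left U V := fun x hx y hy => ⟨y, SpecLE.refl y, Or.inl (U.2.up hy hx)⟩
  le_sup_right U V := fun x hx y hy => ⟨y, SpecLE.refl y, Or.inr (V.2.up hy hx)⟩
  sup_le U V W h1 h2 := fun x hx => by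
    rw [← W.2.regular]
    intro y hy
    obtain ⟨z, hz, hzU | hzV⟩ := hx y hy
    · exact ⟨z, hz, h1 hzU⟩
    · exact ⟨z, hz, h2 hzV⟩
  le_sup_inf U V W := by
    rintro x ⟨hx1, hx2⟩ y hy
    obtain ⟨z, hz, hzU | hzV⟩ := hx1 y hy
    · exact ⟨z, hz, Or.inl hzU⟩
    · obtain ⟨w, hw, hwU | hwW⟩ := hx2 z (hy.trans hz)
      · exact ⟨w, hz.trans hw, Or.inl hwU⟩
      · exact ⟨w, hz.trans hw, Or.inr ⟨V.2.up hw hzV, hwW⟩⟩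
  inf_compl_le_bot _ := fun x hx => hx.2 x (SpecLE.refl x) hx.1
  top_le_sup_compl U := fun x _ y _ => by
    by_cases hc : ∃ z, SpecLE y z ∧ z ∈ U.1
    · obtain ⟨z, hz, hzU⟩ := hc
      exact ⟨z, hz, Or.inl hzU⟩
    · exact ⟨y, SpecLE.refl y, Or.inr fun z hz hzU => hc ⟨z, hz, hzU⟩⟩
  le_top _ := fun _ _ => trivial
  bot_le _ := fun _ hx => hx.elim

end Lemmas

/-- A closure-type operation commuting with relativized meets is a quantifier. -/
lemma IsQuantifier.of_meet {A : Type u} [BooleanAlgebra A] {e : A → A} (h0 : e ⊥ = ⊥)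
    (hle : ∀ a, a ≤ e a) (hm : ∀ a b, e (a ⊓ e b) = e a ⊓ e b) : IsQuantifier e := by
  have idem : ∀ a, e (e a) = e a := fun a => by
    have h := hm ⊤ a
    have ht : e ⊤ = ⊤ := top_le_iff.1 (hle ⊤)
    simpa [ht] using h
  have mono : ∀ {a b}, a ≤ b → e a ≤ e b := fun {a b} hab => by
    have h := hm a b
    rw [inf_eq_left.2 (hab.trans (hle b))] at h
    exact inf_eq_left.1 h.symm
  have compl : ∀ a, e (e a)ᶜ = (e a)ᶜ := fun a => by
    refine le_antisymm ?_ (hle _)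
    have h := hm (e a)ᶜ a
    rw [compl_inf_eq_bot, h0] at h
    exact le_compl_iff_disjoint_right.2 (disjoint_iff.2 h.symm)
  refine ⟨fun a b => le_antisymm ?_ (sup_le (mono le_sup_left) (mono le_sup_right)), h0, idem, hle,
    compl⟩
  have h1 : e (e a ⊔ e b) = e a ⊔ e b := by
    have h2 : e ((e a)ᶜ ⊓ (e b)ᶜ) = (e a)ᶜ ⊓ (e b)ᶜ := by
      have h := hm (e a)ᶜ (e b)ᶜ
      rwa [compl, compl] at h
    have h3 := compl ((e a)ᶜ ⊓ (e b)ᶜ)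
    rw [h2] at h3
    simpa using h3
  exact (mono (sup_le_sup (hle a) (hle b))).trans h1.le


lemma preimage_star {X Y : Type u} [TopologicalSpace X] [TopologicalSpace Y] {f : X → Y}
    (hf : Continuous f) (hb : ∀ x y', SpecLE (f x) y' → ∃ y, SpecLE x y ∧ f y = y') (U : Set Y) :
    f ⁻¹' star U = star (f ⁻¹' U) := by
  ext x
  constructor
  · exact fun hx y hy hyU => hx (f y) (hy.map hf) hyU
  · intro hx y' hy' hU
    obtain ⟨y, hy, rfl⟩ := hb x y' hy'
    exact hx y hy hU

namespace CUV

variable {I : Type v}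

lemma Hom.preimage_mem {X Y : CUV.{u} I} (f : Hom X Y) {U : Set Y.carrier} (hU : IsCOREG U) :
    IsCOREG (f.toFun ⁻¹' U) := by
  refine ⟨hU.isCompact.preimage_of_isOpen f.spectral hU.isOpen,
    hU.isOpen.preimage f.spectral.continuous, ?_⟩
  rw [← star_star, ← preimage_star f.spectral.continuous f.back,
    ← preimage_star f.spectral.continuous f.back, hU.star_star]

instance : Category.{u} (CUV.{u} I) where
  Hom X Y := Hom X Y
  id X :=
    { toFun := id
      spectral := isSpectralMap_id
      back := fun _ y' h => ⟨y', h, rfl⟩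
      preimage_image := fun _ _ _ => rfl
      preimage_diag := fun _ _ => rfl }
  comp f g :=
    { toFun := g.toFun ∘ f.toFun
      spectral := g.spectral.comp f.spectral
      back := fun x z' h => by
        obtain ⟨y', hy', rfl⟩ := g.back _ _ h
        obtain ⟨y, hy, rfl⟩ := f.back _ _ hy'
        exact ⟨y, hy, rfl⟩
      preimage_image := fun i U hU => by
        rw [Set.preimage_comp, Set.preimage_comp, f.preimage_image i _ (g.preimage_mem hU),
          g.preimage_image i U hU]
      preimage_diag := fun i k => by
        rw [Set.preimage_comp, g.preimage_diag, f.preimage_diag] }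

lemma diag_mem (X : CUV.{u} I) (i k : I) : IsCOREG (X.Δ i k) :=
  ⟨X.diag_compact i k, X.diag_open i k, (star_star _).symm.trans (X.diag_regular i k)⟩

lemma image_image_comm (X : CUV.{u} I) (i k : I) (U : Set X.carrier) :
    relImage (X.S i) (relImage (X.S k) U) = relImage (X.S k) (relImage (X.S i) U) := by
  have key : ∀ i k, relImage (X.S i) (relImage (X.S k) U) ⊆
      relImage (X.S k) (relImage (X.S i) U) := by
    rintro i k z ⟨y, ⟨x, hx, hxy⟩, hyz⟩
    have h : Relation.Comp (X.S k) (X.S i) x z := ⟨y, hxy, hyz⟩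
    rw [X.comm k i] at h
    obtain ⟨w, hxw, hwz⟩ := h
    exact ⟨w, ⟨x, hx, hxw⟩, hwz⟩
  exact Set.Subset.antisymm (key i k) (key k i)

end CUV

/-! ### The functor of compact open regular opens -/

/-- The cylindric Boolean algebra of compact open regular open subsets, where the quantifiers are
`U ↦ S i [U]`. -/
def G₀ {I : Type v} (X : CUV.{u} I) : CBA.{u} I :=
  letI : BooleanAlgebra (COREG X.carrier) := X.isUV.booleanAlgebra
  { carrier := COREG X.carrier
    ex := fun i U => ⟨relImage (X.S i) U.1, X.image_mem i _ U.2⟩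
    diag := fun i k => ⟨X.Δ i k, X.diag_mem i k⟩
    quantifier := fun i => IsQuantifier.of_meet
      (Subtype.ext (Set.eq_empty_of_forall_notMem fun _ ⟨_, h, _⟩ => h))
      (fun U x hx => ⟨x, hx, (X.equiv i).refl x⟩)
      (fun U V => Subtype.ext (by
        ext y
        constructor
        · rintro ⟨x, ⟨hxU, z, hzV, hzx⟩, hxy⟩
          exact ⟨⟨x, hxU, hxy⟩, z, hzV, (X.equiv i).trans hzx hxy⟩
        · rintro ⟨⟨x, hxU, hxy⟩, z, hzV, hzy⟩
          exact ⟨x, ⟨hxU, z, hzV, (X.equiv i).trans hzy ((X.equiv i).symm hxy)⟩, hxy⟩))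
    ex_comm := fun i k U => Subtype.ext (X.image_image_comm i k U.1)
    diag_symm := fun i k => Subtype.ext (X.diag_symm i k)
    diag_self := fun i => Subtype.ext (X.diag_self i)
    diag_trans := fun i k l hi hl => Subtype.ext (X.diag_trans i k l hi.symm hl.symm).symm
    diag_disj := fun i k U h => Subtype.ext (X.diag_disj i k h U.1 U.2) }

/-- The action `f ↦ f⁻¹` on cylindric UV-maps. -/
def G₁ {I : Type v} {X Y : CUV.{u} I} (f : X ⟶ Y) : G₀ Y ⟶ G₀ X where
  toFun U := ⟨f.toFun ⁻¹' U.1, CUV.Hom.preimage_mem f U.2⟩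
  map_inf _ _ := rfl
  map_sup U V := Subtype.ext (by
    change f.toFun ⁻¹' intUp (clUp (U.1 ∪ V.1)) =
      intUp (clUp (f.toFun ⁻¹' U.1 ∪ f.toFun ⁻¹' V.1))
    rw [← star_star, ← star_star, preimage_star f.spectral.continuous f.back,
      preimage_star f.spectral.continuous f.back]
    rfl)
  map_bot := rfl
  map_top := rfl
  map_compl U := Subtype.ext (preimage_star f.spectral.continuous f.back U.1)
  map_ex i U := Subtype.ext (f.preimage_image i U.1 U.2).symm
  map_diag i k := Subtype.ext (f.preimage_diag i k)

/-- The contravariant functor from cylindric UV-spaces to cylindric Boolean algebras. -/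
def G (I : Type v) : (CUV.{u} I)ᵒᵖ ⥤ CBA.{u} I where
  obj X := G₀ X.unop
  map f := G₁ f.unop

/-! ### The functor of proper filters -/

/-- The set of proper (non-empty) filters of a Boolean algebra. -/
abbrev ProperFilter (A : Type u) [BooleanAlgebra A] : Type u :=
  {x : Order.PFilter A // (x : Set A) ≠ Set.univ}

/-- `φ a` is the set of proper filters containing `a`. -/
def φ {A : Type u} [BooleanAlgebra A] (a : A) : Set (ProperFilter A) := {x | a ∈ x.1}

/-- The topology generated by the sets `φ a`. -/
instance {A : Type u} [BooleanAlgebra A] : TopologicalSpace (ProperFilter A) :=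
  TopologicalSpace.generateFrom (Set.range φ)

section Filters

variable {A : Type u} [BooleanAlgebra A]

lemma ProperFilter.bot_notMem (x : ProperFilter A) : ⊥ ∉ x.1 := fun h =>
  x.2 (Set.eq_univ_of_forall fun _ => x.1.mem_of_le bot_le h)

/-- The proper filter generated by a non-empty set closed under meets and not containing `⊥`. -/
def ProperFilter.gen (B : Set A) (hne : B.Nonempty) (hinf : ∀ a ∈ B, ∀ b ∈ B, a ⊓ b ∈ B)
    (hbot : ⊥ ∉ B) : ProperFilter A :=
  ⟨Order.IsPFilter.toPFilter (F := {c | ∃ p ∈ B, p ≤ c}) (Order.IsPFilter.of_def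
    (hne.mono fun a ha => ⟨a, ha, le_rfl⟩)
    (by
      rintro a ⟨p, hp, hpa⟩ b ⟨q, hq, hqb⟩
      exact ⟨p ⊓ q, ⟨p ⊓ q, hinf p hp q hq, le_rfl⟩, inf_le_left.trans hpa,
        inf_le_right.trans hqb⟩)
    (by
      rintro a b hab ⟨p, hp, hpa⟩
      exact ⟨p, hp, hpa.trans hab⟩)),
    fun h => by
      have hm : ∃ p ∈ B, p ≤ (⊥ : A) := Set.eq_univ_iff_forall.1 h ⊥
      obtain ⟨p, hp, hpb⟩ := hm
      exact hbot (le_bot_iff.1 hpb ▸ hp)⟩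

lemma ProperFilter.mem_gen {B : Set A} {hne : B.Nonempty} {hinf : ∀ a ∈ B, ∀ b ∈ B, a ⊓ b ∈ B}
    {hbot : ⊥ ∉ B} {c : A} : c ∈ (gen B hne hinf hbot).1 ↔ ∃ p ∈ B, p ≤ c := Iff.rfl

lemma ProperFilter.ext' {x y : ProperFilter A} (h : ∀ a, a ∈ x.1 ↔ a ∈ y.1) : x = y :=
  Subtype.ext (SetLike.ext h)

/-- The principal proper filter of a non-zero element. -/
def ProperFilter.up (a : A) (ha : a ≠ ⊥) : ProperFilter A :=
  gen {a} ⟨a, rfl⟩ (by rintro _ rfl _ rfl; exact inf_idem _) (fun h => ha h.symm)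

lemma ProperFilter.mem_up {a : A} {ha : a ≠ ⊥} {c : A} : c ∈ (up a ha).1 ↔ a ≤ c := by
  refine mem_gen.trans ?_
  simp

lemma φ_inf (a b : A) : φ (a ⊓ b) = φ a ∩ φ b := by
  ext x
  exact Order.PFilter.inf_mem_iff

lemma φ_bot : φ (⊥ : A) = ∅ := Set.eq_empty_of_forall_notMem fun x hx => x.bot_notMem hx

lemma φ_top : φ (⊤ : A) = Set.univ := Set.eq_univ_of_forall fun x => x.1.top_mem

lemma φ_basis : TopologicalSpace.IsTopologicalBasis (Set.range (φ (A := A))) where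
  exists_subset_inter := by
    rintro _ ⟨a, rfl⟩ _ ⟨b, rfl⟩ x hx
    exact ⟨φ (a ⊓ b), ⟨_, rfl⟩, φ_inf a b ▸ hx, (φ_inf a b).le⟩
  sUnion_eq := Set.eq_univ_of_forall fun x => ⟨φ ⊤, ⟨⊤, rfl⟩, x.1.top_mem⟩
  eq_generateFrom := rfl

lemma isOpen_φ (a : A) : IsOpen (φ a) := φ_basis.isOpen ⟨a, rfl⟩

lemma specLE_iff {x y : ProperFilter A} : SpecLE x y ↔ ∀ a, a ∈ x.1 → a ∈ y.1 := by
  constructor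
  · exact fun h a ha => h (φ a) (isOpen_φ a) ha
  · intro h U hU hx
    obtain ⟨_, ⟨a, rfl⟩, hxa, haU⟩ := φ_basis.exists_subset_of_mem_open hx hU
    exact haU (h a hxa)

lemma φ_subset_iff {a b : A} : φ a ⊆ φ b ↔ a ≤ b := by
  constructor
  · intro h
    by_cases ha : a = ⊥
    · exact ha ▸ bot_le
    · exact (ProperFilter.mem_up (ha := ha)).1
        (h (show ProperFilter.up a ha ∈ φ a from (ProperFilter.mem_up (ha := ha) (c := a)).2 le_rfl))
  · exact fun h x hx => x.1.mem_of_le h hx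

lemma φ_injective : Function.Injective (φ (A := A)) := fun _ _ h =>
  le_antisymm (φ_subset_iff.1 h.le) (φ_subset_iff.1 h.ge)

lemma isCompact_φ (a : A) : IsCompact (φ a) := by
  by_cases ha : a = ⊥
  · rw [ha, φ_bot]
    exact isCompact_empty
  · refine isCompact_of_finite_subcover fun {ι} U hU hcov => ?_
    obtain ⟨i, hi⟩ := Set.mem_iUnion.1
      (hcov (show ProperFilter.up a ha ∈ φ a from (ProperFilter.mem_up (ha := ha) (c := a)).2 le_rfl))
    refine ⟨{i}, fun x hx => ?_⟩
    simp only [Finset.mem_singleton, Set.iUnion_iUnion_eq_left]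
    exact specLE_iff.2 (fun b hb => x.1.mem_of_le (ProperFilter.mem_up.1 hb) hx) _ (hU i) hi

/-- A filter not containing `a` extends to one containing `aᶜ`. -/
lemma exists_compl {x : ProperFilter A} {a : A} (ha : a ∉ x.1) :
    ∃ y : ProperFilter A, SpecLE x y ∧ aᶜ ∈ y.1 := by
  refine ⟨ProperFilter.gen {c | ∃ p ∈ x.1, c = p ⊓ aᶜ} ⟨_, ⊤, x.1.top_mem, rfl⟩ ?_ ?_, ?_, ?_⟩
  · rintro _ ⟨p, hp, rfl⟩ _ ⟨q, hq, rfl⟩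
    exact ⟨p ⊓ q, x.1.inf_mem hp hq, by rw [inf_inf_inf_comm, inf_idem]⟩
  · rintro ⟨p, hp, h⟩
    exact ha (x.1.mem_of_le (disjoint_compl_right_iff.1 (disjoint_iff.2 h.symm)) hp)
  · exact specLE_iff.2 fun p hp => ⟨p ⊓ aᶜ, ⟨p, hp, rfl⟩, inf_le_left⟩
  · exact ⟨⊤ ⊓ aᶜ, ⟨⊤, x.1.top_mem, rfl⟩, inf_le_right⟩

lemma star_φ (a : A) : star (φ a) = φ aᶜ := by
  ext x
  constructor
  · intro hx
    by_contra hc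
    obtain ⟨y, hy, hya⟩ := exists_compl (a := aᶜ) hc
    exact hx y hy (compl_compl a ▸ hya)
  · intro hx y hy hya
    refine y.bot_notMem ?_
    rw [← inf_compl_eq_bot (a := a)]
    exact y.1.inf_mem hya (specLE_iff.1 hy _ hx)

lemma isCOREG_φ (a : A) : IsCOREG (φ a) :=
  ⟨isCompact_φ a, isOpen_φ a, by rw [← star_star, star_φ, star_φ, compl_compl]⟩

lemma isCOREG_iff {U : Set (ProperFilter A)} : IsCOREG U ↔ ∃ a, U = φ a := by
  constructor
  · intro hU
    have key : ∃ b : A, star U = φ b := by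
      obtain ⟨s, hs, rfl⟩ := (isCompact_open_iff_eq_finite_iUnion_of_isTopologicalBasis φ φ_basis
        isCompact_φ U).1 ⟨hU.isCompact, hU.isOpen⟩
      clear hU
      induction s, hs using Set.Finite.induction_on with
      | empty => exact ⟨⊤, by simp [star_empty, φ_top]⟩
      | @insert a s _ _ ih =>
        obtain ⟨b, hb⟩ := ih
        exact ⟨aᶜ ⊓ b, by rw [Set.biUnion_insert, star_union, hb, star_φ, φ_inf]⟩
    obtain ⟨b, hb⟩ := key
    exact ⟨bᶜ, by rw [← hU.star_star, hb, star_φ]⟩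
  · rintro ⟨a, rfl⟩
    exact isCOREG_φ a

/-- `x ∩ {closed elements}` is the direct image of a filter under a quantifier. -/
lemma mem_image_quantifier {e : A → A} (he : IsQuantifier e) (x : ProperFilter A) (c : A) :
    c ∈ e '' (x.1 : Set A) ↔ c ∈ x.1 ∧ e c = c := by
  constructor
  · rintro ⟨a, ha, rfl⟩
    exact ⟨x.1.mem_of_le (he.le a) ha, he.idem a⟩
  · rintro ⟨hc, h⟩
    exact ⟨c, hc, h⟩

/-- `x` and `y` have the same direct image under `e`. -/
def filterRel (e : A → A) (x y : ProperFilter A) : Prop :=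
  e '' (x.1 : Set A) = e '' (y.1 : Set A)

lemma filterRel_iff {e : A → A} (he : IsQuantifier e) {x y : ProperFilter A} :
    filterRel e x y ↔ ∀ c, e c = c → (c ∈ x.1 ↔ c ∈ y.1) := by
  unfold filterRel
  rw [Set.ext_iff]
  refine forall_congr' fun c => ?_
  rw [mem_image_quantifier he, mem_image_quantifier he]
  tauto

lemma filterRel_equivalence (e : A → A) : Equivalence (filterRel e) :=
  ⟨fun _ => rfl, fun h => h.symm, fun h h' => h.trans h'⟩

lemma IsQuantifier.mono {e : A → A} (he : IsQuantifier e) {a b : A} (h : a ≤ b) : e a ≤ e b := by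
  rw [← sup_eq_right.2 h, he.map_sup]
  exact le_sup_left

/-- If `q ⊓ p ≤ c` with `p`, `c` closed, then `e q ⊓ p ≤ c`. -/
lemma IsQuantifier.ex_inf_le {e : A → A} (he : IsQuantifier e) {p q c : A} (hp : e p = p)
    (hc : e c = c) (h : q ⊓ p ≤ c) : e q ⊓ p ≤ c := by
  have h1 : q ≤ pᶜ ⊔ c := by
    rw [sup_comm, ← le_himp_iff, himp_eq] at *
    exact h
  have h2 : e (pᶜ ⊔ c) = pᶜ ⊔ c := by
    rw [he.map_sup, hc]
    have := he.map_compl p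
    rw [hp] at this
    rw [this]
  have h3 := he.mono h1
  rw [h2, sup_comm, ← himp_eq, le_himp_iff] at h3
  exact h3

lemma relImage_φ {e : A → A} (he : IsQuantifier e) (a : A) :
    relImage (filterRel e) (φ a) = φ (e a) := by
  ext y
  constructor
  · rintro ⟨x, hx, hxy⟩
    exact ((filterRel_iff he).1 hxy _ (he.idem a)).1 (x.1.mem_of_le (he.le a) hx)
  · intro hy
    have key : ∀ p ∈ y.1, e p = p → ∀ c, e c = c → a ⊓ p ≤ c → c ∈ y.1 := fun p hp hp' c hc h =>
      y.1.mem_of_le (he.ex_inf_le hp' hc h) (y.1.inf_mem hy hp)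
    have inf_closed : ∀ p q, e p = p → e q = q → e (p ⊓ q) = p ⊓ q := fun p q hp hq =>
      le_antisymm (le_inf ((he.mono inf_le_left).trans hp.le) ((he.mono inf_le_right).trans hq.le))
        (he.le _)
    refine ⟨ProperFilter.gen {c | ∃ p ∈ y.1, e p = p ∧ c = a ⊓ p}
      ⟨_, ⊤, y.1.top_mem, top_le_iff.1 (he.le ⊤), rfl⟩ ?_ ?_, ?_, ?_⟩
    · rintro _ ⟨p, hp, hp', rfl⟩ _ ⟨q, hq, hq', rfl⟩
      exact ⟨p ⊓ q, y.1.inf_mem hp hq, inf_closed p q hp' hq', by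
        rw [inf_inf_inf_comm, inf_idem]⟩
    · rintro ⟨p, hp, hp', h⟩
      exact y.bot_notMem (key p hp hp' ⊥ he.map_bot h.ge)
    · exact ⟨a ⊓ ⊤, ⟨⊤, y.1.top_mem, top_le_iff.1 (he.le ⊤), rfl⟩, inf_le_left⟩
    · refine (filterRel_iff he).2 fun c hc => ⟨?_, fun h => ?_⟩
      · rintro ⟨_, ⟨p, hp, hp', rfl⟩, h⟩
        exact key p hp hp' c hc h
      · exact ⟨a ⊓ c, ⟨c, h, hc, rfl⟩, inf_le_right⟩

lemma filterRel_comm_le {e f : A → A} (he : IsQuantifier e) (hf : IsQuantifier f)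
    (hef : ∀ a, e (f a) = f (e a)) {x z : ProperFilter A}
    (h : Relation.Comp (filterRel e) (filterRel f) x z) :
    Relation.Comp (filterRel f) (filterRel e) x z := by
  obtain ⟨y, hxy, hyz⟩ := h
  rw [filterRel_iff he] at hxy
  rw [filterRel_iff hf] at hyz
  have inf_closed : ∀ {e : A → A}, IsQuantifier e → ∀ p q, e p = p → e q = q →
      e (p ⊓ q) = p ⊓ q := fun he p q hp hq =>
    le_antisymm (le_inf ((he.mono inf_le_left).trans hp.le) ((he.mono inf_le_right).trans hq.le))
      (he.le _)
  have key1 : ∀ p ∈ x.1, f p = p → ∀ q ∈ z.1, e q = q → ∀ c, f c = c → p ⊓ q ≤ c → c ∈ x.1 := by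
    intro p hp hp' q hq hq' c hc h
    refine x.1.mem_of_le (hf.ex_inf_le (q := q) hp' hc (inf_comm p q ▸ h)) (x.1.inf_mem ?_ hp)
    refine (hxy (f q) (by rw [hef, hq'])).2 ((hyz (f q) (hf.idem q)).2 ?_)
    exact z.1.mem_of_le (hf.le q) hq
  have key2 : ∀ p ∈ x.1, f p = p → ∀ q ∈ z.1, e q = q → ∀ c, e c = c → p ⊓ q ≤ c → c ∈ z.1 := by
    intro p hp hp' q hq hq' c hc h
    refine z.1.mem_of_le (he.ex_inf_le (q := p) hq' hc h) (z.1.inf_mem ?_ hq)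
    refine (hyz (e p) (by rw [← hef, hp'])).1 ((hxy (e p) (he.idem p)).1 ?_)
    exact x.1.mem_of_le (he.le p) hp
  have ht : ∀ {e : A → A}, IsQuantifier e → e ⊤ = ⊤ := fun he => top_le_iff.1 (he.le ⊤)
  refine ⟨ProperFilter.gen {c | ∃ p ∈ x.1, f p = p ∧ ∃ q ∈ z.1, e q = q ∧ c = p ⊓ q}
    ⟨_, ⊤, x.1.top_mem, ht hf, ⊤, z.1.top_mem, ht he, rfl⟩ ?_ ?_, ?_, ?_⟩
  · rintro _ ⟨p, hp, hp', q, hq, hq', rfl⟩ _ ⟨r, hr, hr', s, hs, hs', rfl⟩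
    exact ⟨p ⊓ r, x.1.inf_mem hp hr, inf_closed hf p r hp' hr', q ⊓ s, z.1.inf_mem hq hs,
      inf_closed he q s hq' hs', inf_inf_inf_comm _ _ _ _⟩
  · rintro ⟨p, hp, hp', q, hq, hq', h⟩
    exact x.bot_notMem (key1 p hp hp' q hq hq' ⊥ hf.map_bot h.ge)
  · refine (filterRel_iff hf).2 fun c hc => ⟨fun h => ?_, ?_⟩
    · exact ⟨c ⊓ ⊤, ⟨c, h, hc, ⊤, z.1.top_mem, ht he, rfl⟩, inf_le_left⟩
    · rintro ⟨_, ⟨p, hp, hp', q, hq, hq', rfl⟩, h⟩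
      exact key1 p hp hp' q hq hq' c hc h
  · refine (filterRel_iff he).2 fun c hc => ⟨?_, fun h => ?_⟩
    · rintro ⟨_, ⟨p, hp, hp', q, hq, hq', rfl⟩, h⟩
      exact key2 p hp hp' q hq hq' c hc h
    · exact ⟨⊤ ⊓ c, ⟨⊤, x.1.top_mem, ht hf, c, h, hc, rfl⟩, inf_le_right⟩

variable (A) in
lemma isUVSpace_properFilter : IsUVSpace (ProperFilter A) where
  t0 := ⟨fun x y h => ProperFilter.ext' fun a =>
    (inseparable_iff_forall_isOpen.1 h) (φ a) (isOpen_φ a)⟩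
  inter_mem U V hU hV := by
    obtain ⟨a, rfl⟩ := isCOREG_iff.1 hU
    obtain ⟨b, rfl⟩ := isCOREG_iff.1 hV
    exact φ_inf a b ▸ isCOREG_φ _
  star_mem U hU := by
    obtain ⟨a, rfl⟩ := isCOREG_iff.1 hU
    exact star_φ a ▸ isCOREG_φ _
  isBasis := by
    have h : {U : Set (ProperFilter A) | IsCOREG U} = Set.range φ := by
      ext U
      exact isCOREG_iff.trans ⟨fun ⟨a, h⟩ => ⟨a, h.symm⟩, fun ⟨a, h⟩ => ⟨a, h.symm⟩⟩
    exact h ▸ φ_basis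
  exists_point F hF := by
    let P : A → COREG (ProperFilter A) := fun a => ⟨φ a, isCOREG_φ a⟩
    have hP : ∀ {a b}, a ≤ b → P a ≤ P b := fun h => φ_subset_iff.2 h
    have hsurj : ∀ U, ∃ a, U = P a := fun U => by
      obtain ⟨a, ha⟩ := isCOREG_iff.1 U.2
      exact ⟨a, Subtype.ext ha⟩
    refine ⟨ProperFilter.gen {a | P a ∈ F} ?_ ?_ ?_, ?_⟩
    · obtain ⟨U, hU⟩ := F.nonempty
      obtain ⟨a, rfl⟩ := hsurj U
      exact ⟨a, hU⟩
    · intro a ha b hb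
      obtain ⟨W, hW, hWa, hWb⟩ := F.directed (P a) ha (P b) hb
      refine F.mem_of_le (x := W) (fun x hx => ?_) hW
      exact (φ_inf a b).ge ⟨hWa hx, hWb hx⟩
    · intro h
      refine hF (Set.eq_univ_of_forall fun U => F.mem_of_le (x := P ⊥) (fun x hx => ?_) h)
      exact (x.bot_notMem hx).elim
    · ext U
      obtain ⟨a, rfl⟩ := hsurj U
      exact ⟨fun h => ⟨a, h, le_rfl⟩, fun ⟨p, hp, hpa⟩ => F.mem_of_le (hP hpa) hp⟩

end Filters

/-- The spectrum of proper filters of a cylindric Boolean algebra, with `x S_i y` iff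
`∃_i [x] = ∃_i [y]` and `Δ_{i,k} = φ (δ_{i,k})`. -/
def F₀ {I : Type v} (A : CBA.{u} I) : CUV.{u} I where
  carrier := ProperFilter A.carrier
  S i := filterRel (A.ex i)
  Δ i k := φ (A.diag i k)
  isUV := isUVSpace_properFilter A.carrier
  equiv i := filterRel_equivalence (A.ex i)
  comm i k := by
    ext x z
    exact ⟨filterRel_comm_le (A.quantifier i) (A.quantifier k) (A.ex_comm i k),
      filterRel_comm_le (A.quantifier k) (A.quantifier i) (A.ex_comm k i)⟩
  diag_regular i k := (isCOREG_φ _).star_star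
  diag_symm i k := by rw [A.diag_symm]
  diag_self i := by rw [A.diag_self, φ_top]
  diag_trans i k l hi hl := by
    rw [← φ_inf, relImage_φ (A.quantifier k), ← A.diag_trans i k l hi.symm hl.symm]
  diag_disj i k h U hU := by
    obtain ⟨a, rfl⟩ := isCOREG_iff.1 hU
    rw [star_φ, ← φ_inf, ← φ_inf, relImage_φ (A.quantifier i), relImage_φ (A.quantifier i),
      ← φ_inf, A.diag_disj i k a h, φ_bot]
  image_mem i U hU := by
    obtain ⟨a, rfl⟩ := isCOREG_iff.1 hU
    exact relImage_φ (A.quantifier i) a ▸ isCOREG_φ _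
  separated i x y hxy h := by
    refine hxy ?_
    have key : ∀ x : ProperFilter A.carrier, relImage (filterRel (A.ex i)) ''
        {U | IsCOREG U ∧ x ∈ U} = φ '' (A.ex i '' (x.1 : Set A.carrier)) := by
      intro x
      ext V
      constructor
      · rintro ⟨U, ⟨hU, hx⟩, rfl⟩
        obtain ⟨a, rfl⟩ := isCOREG_iff.1 hU
        exact ⟨_, ⟨a, hx, rfl⟩, (relImage_φ (A.quantifier i) a).symm⟩
      · rintro ⟨_, ⟨a, hx, rfl⟩, rfl⟩
        exact ⟨φ a, ⟨isCOREG_φ a, hx⟩, relImage_φ (A.quantifier i) a⟩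
    rw [key, key] at h
    exact φ_injective.image_injective h
  diag_compact i k := isCompact_φ _
  diag_open i k := isOpen_φ _

/-- The preimage of a proper filter under a homomorphism. -/
def comapFilter {I : Type v} {A B : CBA.{u} I} (h : A ⟶ B) (x : ProperFilter B.carrier) :
    ProperFilter A.carrier :=
  ⟨Order.IsPFilter.toPFilter (F := h.toFun ⁻¹' (x.1 : Set B.carrier)) (Order.IsPFilter.of_def
    ⟨⊤, by
      rw [Set.mem_preimage, h.map_top]
      exact x.1.top_mem⟩
    (fun a ha b hb => ⟨a ⊓ b, by
      rw [Set.mem_preimage, h.map_inf]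
      exact x.1.inf_mem ha hb, inf_le_left, inf_le_right⟩)
    (by
      intro a b hab ha
      have hb : h.toFun a ≤ h.toFun b := by
        rw [← inf_eq_left, ← h.map_inf, inf_eq_left.2 hab]
      exact x.1.mem_of_le hb ha)),
    fun hu => x.bot_notMem (by
      have hm : h.toFun ⊥ ∈ x.1 := Set.eq_univ_iff_forall.1 hu ⊥
      rwa [h.map_bot] at hm)⟩

lemma mem_comapFilter {I : Type v} {A B : CBA.{u} I} {h : A ⟶ B} {x : ProperFilter B.carrier}
    {a : A.carrier} : a ∈ (comapFilter h x).1 ↔ h.toFun a ∈ x.1 := Iff.rfl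

lemma preimage_φ {I : Type v} {A B : CBA.{u} I} (h : A ⟶ B) (a : A.carrier) :
    comapFilter h ⁻¹' φ a = φ (h.toFun a) := rfl

lemma isSpectralMap_comapFilter {I : Type v} {A B : CBA.{u} I} (h : A ⟶ B) :
    IsSpectralMap (comapFilter h) := by
  have hc : Continuous (comapFilter h) := by
    refine continuous_generateFrom_iff.2 ?_
    rintro _ ⟨a, rfl⟩
    exact isOpen_φ _
  refine ⟨hc, fun {U} hU hU' => ?_⟩
  obtain ⟨s, hs, rfl⟩ := (isCompact_open_iff_eq_finite_iUnion_of_isTopologicalBasis φ φ_basis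
    isCompact_φ U).1 ⟨hU', hU⟩
  rw [Set.preimage_iUnion₂]
  exact hs.isCompact_biUnion fun a _ => isCompact_φ (h.toFun a)

/-- The action `h ↦ h⁻¹` on homomorphisms. -/
def F₁ {I : Type v} {A B : CBA.{u} I} (h : A ⟶ B) : F₀ B ⟶ F₀ A where
  toFun := comapFilter h
  spectral := isSpectralMap_comapFilter h
  back x y' hy' := by
    replace hy' := specLE_iff.1 hy'
    have hmono : ∀ {a b}, a ≤ b → h.toFun a ≤ h.toFun b := fun {a b} hab => by
      rw [← inf_eq_left, ← h.map_inf, inf_eq_left.2 hab]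
    have key : ∀ p ∈ x.1, ∀ q ∈ y'.1, ∀ a, p ⊓ h.toFun q ≤ h.toFun a → a ∈ y'.1 := by
      intro p hp q hq a hpq
      have h1 : a ⊔ qᶜ ∈ y'.1 := by
        refine hy' _ (mem_comapFilter.2 (x.1.mem_of_le ?_ hp))
        rw [h.map_sup, h.map_compl, ← himp_eq, le_himp_iff]
        exact hpq
      refine y'.1.mem_of_le ?_ (y'.1.inf_mem h1 hq)
      rw [← le_himp_iff, himp_eq]
    refine ⟨ProperFilter.gen {c | ∃ p ∈ x.1, ∃ q ∈ y'.1, c = p ⊓ h.toFun q}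
      ⟨_, ⊤, x.1.top_mem, ⊤, y'.1.top_mem, rfl⟩ ?_ ?_, ?_, ?_⟩
    · rintro _ ⟨p, hp, q, hq, rfl⟩ _ ⟨r, hr, s, hs, rfl⟩
      exact ⟨p ⊓ r, x.1.inf_mem hp hr, q ⊓ s, y'.1.inf_mem hq hs, by
        rw [h.map_inf, inf_inf_inf_comm]⟩
    · rintro ⟨p, hp, q, hq, he⟩
      exact y'.bot_notMem (key p hp q hq ⊥ (he.ge.trans bot_le))
    · exact specLE_iff.2 fun p hp => ⟨p ⊓ h.toFun ⊤, ⟨p, hp, ⊤, y'.1.top_mem, rfl⟩, inf_le_left⟩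
    · refine ProperFilter.ext' fun a => ⟨?_, fun ha => ?_⟩
      · rintro ⟨_, ⟨p, hp, q, hq, rfl⟩, hle⟩
        exact key p hp q hq a hle
      · exact ⟨⊤ ⊓ h.toFun a, ⟨⊤, x.1.top_mem, a, ha, rfl⟩, inf_le_right⟩
  preimage_image i U hU := by
    obtain ⟨a, rfl⟩ := isCOREG_iff.1 hU
    change relImage (filterRel (B.ex i)) (φ (h.toFun a)) =
      comapFilter h ⁻¹' relImage (filterRel (A.ex i)) (φ a)
    rw [relImage_φ (B.quantifier i), relImage_φ (A.quantifier i), preimage_φ, h.map_ex]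
  preimage_diag i k := by
    change comapFilter h ⁻¹' φ (A.diag i k) = φ (B.diag i k)
    rw [preimage_φ, h.map_diag]

/-- The contravariant functor from cylindric Boolean algebras to cylindric UV-spaces. -/
def F (I : Type v) : (CBA.{u} I)ᵒᵖ ⥤ CUV.{u} I where
  obj A := F₀ A.unop
  map h := F₁ h.unop

end CylDual

/-!
A proper filter `x` lies in `star (φ a)` iff `aᶜ ∈ x`, since otherwise `x` extends to a proper
filter containing `a`; hence the compact open regular sets of the filter space are exactly the
`φ a`, and `φ` identifies `A` with them as an ordered set. The Boolean operations are determined by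
the order, so only the quantifiers and the diagonals remain to be compared, and the image of `φ a`
under `S i` is `φ (A.ex i a)`. On the space side, the sets in `COREG X` determine the topology and
every proper filter of them comes from a point, so sending a point to the filter of its `COREG`
neighbourhoods is a homeomorphism; the separation axiom makes it reflect the relations `S i`.
-/

namespace CylDual

section UVDuality

/-- The representation `a ↦ φ a` of a Boolean algebra by the compact open regular open sets of
its space of proper filters. -/
noncomputable def orderIsoCOREG (A : Type u) [BooleanAlgebra A] :
    A ≃o COREG (ProperFilter A) :=
  RelIso.ofSurjective (OrderEmbedding.ofMapLEIff (fun a => ⟨φ a, isCOREG_φ a⟩) fun _ _ =>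
    φ_subset_iff) fun U =>
      (isCOREG_iff.1 U.2).imp fun _ hU => Subtype.ext hU.symm

variable {X : Type u} [TopologicalSpace X]

/-- The space of proper filters of the Boolean algebra of compact open regular open subsets of a
UV-space. -/
abbrev IsUVSpace.FilterSpace (h : IsUVSpace X) : Type u :=
  @ProperFilter (COREG X) h.booleanAlgebra

/-- The proper filter of the compact open regular open neighbourhoods of a point, written
`COREG_X(x)` in the paper. -/
def IsUVSpace.coregFilter (h : IsUVSpace X) (x : X) : h.FilterSpace :=
  ⟨Order.IsPFilter.toPFilter (F := {U : COREG X | x ∈ U.1}) (Order.IsPFilter.of_def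
    ⟨⟨Set.univ, h.univ_mem⟩, trivial⟩
    (fun U hU V hV => ⟨⟨U.1 ∩ V.1, h.inter_mem _ _ U.2 V.2⟩, ⟨hU, hV⟩,
      Set.inter_subset_left, Set.inter_subset_right⟩)
    (fun hUV hU => hUV hU)),
    fun huniv => (Set.eq_univ_iff_forall.1 huniv ⟨∅, isCOREG_empty⟩ : x ∈ (∅ : Set X))⟩

lemma IsUVSpace.preimage_coregFilter_image_range_φ (h : IsUVSpace X) :
    letI := h.booleanAlgebra
    Set.preimage h.coregFilter '' Set.range φ = {U : Set X | IsCOREG U} := by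
  let := h.booleanAlgebra
  rw [← Set.range_comp]
  exact Subtype.range_val

lemma IsUVSpace.isInducing_coregFilter (h : IsUVSpace X) :
    Topology.IsInducing h.coregFilter where
  eq_induced := h.isBasis.eq_generateFrom.trans (by
    rw [← h.preimage_coregFilter_image_range_φ]
    exact induced_generateFrom_eq.symm)

lemma IsUVSpace.coregFilter_bijective (h : IsUVSpace X) : Function.Bijective h.coregFilter := by
  have := h.t0
  refine ⟨h.isInducing_coregFilter.injective, fun F => ?_⟩
  obtain ⟨x, hx⟩ := h.exists_point F.1 F.2
  exact ⟨x, Subtype.ext (SetLike.coe_injective hx.symm)⟩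

/-- The identification of a UV-space with the space of proper filters of its Boolean algebra of
compact open regular open sets. -/
noncomputable def IsUVSpace.coregHomeomorph (h : IsUVSpace X) : X ≃ₜ h.FilterSpace :=
  (Equiv.ofBijective _ h.coregFilter_bijective).toHomeomorphOfIsInducing h.isInducing_coregFilter

end UVDuality

variable {I : Type v}

namespace CBA

variable {A B : CBA.{u} I}

/-- An order isomorphism commuting with the quantifiers and preserving the diagonals, as a
homomorphism of cylindric Boolean algebras. -/
def homOfOrderIso (e : A.carrier ≃o B.carrier) (map_ex : ∀ i a, e (A.ex i a) = B.ex i (e a))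
    (map_diag : ∀ i k, e (A.diag i k) = B.diag i k) : A ⟶ B where
  toFun := e
  map_inf := e.map_inf
  map_sup := e.map_sup
  map_bot := e.map_bot
  map_top := e.map_top
  map_compl := map_compl' e
  map_ex := map_ex
  map_diag := map_diag

/-- An order isomorphism commuting with the quantifiers and preserving the diagonals, as an
isomorphism of cylindric Boolean algebras. -/
def isoOfOrderIso (e : A.carrier ≃o B.carrier) (map_ex : ∀ i a, e (A.ex i a) = B.ex i (e a))
    (map_diag : ∀ i k, e (A.diag i k) = B.diag i k) : A ≅ B where
  hom := homOfOrderIso e map_ex map_diag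
  inv := homOfOrderIso e.symm
    (fun i b => by rw [e.symm_apply_eq, map_ex, e.apply_symm_apply])
    (fun i k => by rw [e.symm_apply_eq, map_diag])
  hom_inv_id := Hom.ext (funext e.symm_apply_apply)
  inv_hom_id := Hom.ext (funext e.apply_symm_apply)

/-- The isomorphism `a ↦ φ a` of a cylindric Boolean algebra with its double dual. -/
noncomputable def doubleDualIso (A : CBA.{u} I) : A ≅ G₀ (F₀ A) :=
  isoOfOrderIso (B := G₀ (F₀ A)) (orderIsoCOREG A.carrier)
    (fun i a => Subtype.ext (relImage_φ (A.quantifier i) a).symm) (fun _ _ => rfl)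

lemma doubleDualIso_hom_naturality (h : A ⟶ B) :
    h ≫ B.doubleDualIso.hom = A.doubleDualIso.hom ≫ G₁ (F₁ h) := rfl

end CBA

namespace CUV

variable {X Y : CUV.{u} I}

/-- A homeomorphism preserving and reflecting the relations and the diagonals, as a cylindric
UV-map. -/
def homOfHomeomorph (e : X.carrier ≃ₜ Y.carrier)
    (rel_iff : ∀ i x y, X.S i x y ↔ Y.S i (e x) (e y))
    (preimage_diag : ∀ i k, e ⁻¹' Y.Δ i k = X.Δ i k) : X ⟶ Y where
  toFun := e
  spectral := ⟨e.continuous, fun {_} _ hU => e.isCompact_preimage.2 hU⟩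
  back x y' h := ⟨e.symm y', by simpa using h.map e.symm.continuous, e.apply_symm_apply y'⟩
  preimage_image i U _ := by
    ext y
    simp only [relImage, rel_iff, Set.mem_preimage, Set.mem_ofPred_eq]
    exact e.exists_congr_left.trans (by simp)
  preimage_diag := preimage_diag

/-- A homeomorphism preserving and reflecting the relations and the diagonals, as an isomorphism
of cylindric UV-spaces. -/
def isoOfHomeomorph (e : X.carrier ≃ₜ Y.carrier)
    (rel_iff : ∀ i x y, X.S i x y ↔ Y.S i (e x) (e y))
    (preimage_diag : ∀ i k, e ⁻¹' Y.Δ i k = X.Δ i k) : X ≅ Y where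
  hom := homOfHomeomorph e rel_iff preimage_diag
  inv := homOfHomeomorph e.symm
    (fun i x y => by rw [rel_iff, e.apply_symm_apply, e.apply_symm_apply])
    (fun i k => by
      rw [← preimage_diag]
      exact e.toEquiv.symm_preimage_preimage _)
  hom_inv_id := Hom.ext (funext e.symm_apply_apply)
  inv_hom_id := Hom.ext (funext e.apply_symm_apply)

lemma val_image_ex_image_coregFilter (X : CUV.{u} I) (i : I) (x : X.carrier) :
    Subtype.val '' ((G₀ X).ex i '' ((X.isUV.coregFilter x).1 : Set (COREG X.carrier))) =
      relImage (X.S i) '' {U | IsCOREG U ∧ x ∈ U} := by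
  ext V
  constructor
  · rintro ⟨_, ⟨U, hxU, rfl⟩, rfl⟩
    exact ⟨U.1, ⟨U.2, hxU⟩, rfl⟩
  · rintro ⟨U, ⟨hU, hxU⟩, rfl⟩
    exact ⟨_, ⟨⟨U, hU⟩, hxU, rfl⟩, rfl⟩

lemma rel_iff_filterRel_coregFilter (X : CUV.{u} I) (i : I) (x y : X.carrier) :
    X.S i x y ↔ filterRel ((G₀ X).ex i) (X.isUV.coregFilter x) (X.isUV.coregFilter y) := by
  constructor
  · refine fun hxy => (filterRel_iff ((G₀ X).quantifier i)).2 fun C hC => ?_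
    have closed : relImage (X.S i) C.1 = C.1 := congrArg Subtype.val hC
    have mem_of_rel {z w : X.carrier} (hzw : X.S i z w) (hz : z ∈ C.1) : w ∈ C.1 :=
      closed ▸ ⟨z, hz, hzw⟩
    exact ⟨mem_of_rel hxy, mem_of_rel ((X.equiv i).symm hxy)⟩
  · refine fun hxy => not_imp_not.1 (X.separated i x y) ?_
    rw [← X.val_image_ex_image_coregFilter, ← X.val_image_ex_image_coregFilter]
    exact congrArg (Subtype.val '' ·) hxy

/-- The isomorphism of a cylindric UV-space with its double dual, sending a point to the filter of
its compact open regular open neighbourhoods. -/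
noncomputable def doubleDualIso (X : CUV.{u} I) : X ≅ F₀ (G₀ X) :=
  isoOfHomeomorph (Y := F₀ (G₀ X)) X.isUV.coregHomeomorph X.rel_iff_filterRel_coregFilter
    (fun _ _ => rfl)

lemma doubleDualIso_hom_naturality (f : X ⟶ Y) :
    f ≫ Y.doubleDualIso.hom = X.doubleDualIso.hom ≫ F₁ (G₁ f) := rfl

end CUV

/-- The unit of the duality, with components the opposites of `CBA.doubleDualIso`. -/
noncomputable def unitIso (I : Type v) : 𝟭 (CBA.{u} I)ᵒᵖ ≅ F I ⋙ (G I).rightOp :=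
  (NatIso.ofComponents (fun A => A.unop.doubleDualIso.op) fun h =>
    Quiver.Hom.unop_inj (CBA.doubleDualIso_hom_naturality h.unop).symm).symm

/-- The counit of the duality, with components the inverses of `CUV.doubleDualIso`. -/
noncomputable def counitIso (I : Type v) : (G I).rightOp ⋙ F I ≅ 𝟭 (CUV.{u} I) :=
  (NatIso.ofComponents (fun X => X.doubleDualIso) CUV.doubleDualIso_hom_naturality).symm

end CylDual

theorem mainTheorem6 (I : Type v) :
    ∃ e : (CylDual.CBA.{u} I)ᵒᵖ ≌ CylDual.CUV.{u} I,
      e.functor = CylDual.F I ∧ e.inverse = (CylDual.G I).rightOp :=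
  ⟨.mk (CylDual.F I) (CylDual.G I).rightOp (CylDual.unitIso I) (CylDual.counitIso I), rfl, rfl⟩
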